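/- Let $N\ge 1$. Let $L_0[u]=\tfrac12$, $L_1[u],L_2[u],\dots$ be the differential polynomials in $u$ determined by the Lenard recursion $\frac{d}{dz}L_{k+1}[u]=\left(\frac{d^3}{dz^3}+4u\frac{d}{dz}+2u_z\right)L_k[u]$, where $L_{k+1}$ has no constant term, and let $$P_2^{(N)}[w,\alpha]=\left(\frac{d}{dz}+2w\right)L_N[w'-w^2]-zw-\alpha=0$$ be the $N$-th equation of the second Painlevé hierarchy. Let $Q_0^{(N)}=1$ and, for $n\ge1$, let $Q_n^{(N)}\in\mathbb C[z]$ be a monic polynomial such that $w=\frac{d}{dz}\ln\bigl(Q_{n-1}^{(N)}/Q_n^{(N)}\bigr)$ is a rational solution of $P_2^{(N)}[w,n]=0$. Put $p_n=n(n+1)/2$. (1) For every $\alpha\in\mathbb C$ there is exactly one formal series $w=\sum_{m\ge0}c_{\alpha,-(m+1)}z^{-m-1}$ satisfying $P_2^{(N)}[w,\alpha]=0$; moreover $c_{\alpha,-1}=-\alpha$ and $c_{\alpha,-(m+1)}=0$ unless $(2N+1)\mid m$. (2) Let $n\ge0$ be such that $Q_0^{(N)},\dots,Q_n^{(N)}$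 exist. Then $Q_n^{(N)}$ is unique, $\deg Q_n^{(N)}=p_n=-\sum_{i=1}^n c_{i,-1}$, and for every $m\ge1$ the sum $s_{n,m}$ of the $m$-th powers of the roots of $Q_n^{(N)}$, counted with multiplicity, is $s_{n,m}=-\sum_{i=2}^n c_{i,-(m+1)}$. Write $Q_n^{(N)}(z)=\sum_{m=0}^{p_n}A_{n,m}z^{p_n-m}$. Then all the coefficients $A_{n,m}$ are determined by the first $p_n+1$ coefficients $c_{i,-(m+1)}$, $0\le m\le p_n$, of the expansions with $\alpha=i$, $1\le i\le n$: the numbers $A_{n,0},\dots,A_{n,p_n}$ are the unique solution of Newton's identities $$A_{n,0}=1,\qquad mA_{n,m}+\sum_{j=1}^m s_{n,j}A_{n,m-j}=0\quad(1\le m\le p_n),\qquad s_{n,j}=-\sum_{i=2}^n c_{i,-(j+1)}.$$ (3) For such $n$, $A_{n,m}=0$ for all $0\le m\le p_n$ with $(2N+1)\nmid m$. Hence $Q_n^{(N)}(z)=z^r q(z^{2N+1})$ with $r=p_n \bmod (2N+1)$ and a polynomial $q$ of degree $\lfloor n(n+1)/(4N+2)\rfloor$. In particular, if $n\equiv 0$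 or $n\equiv 2N \pmod{2N+1}$, then $(2N+1)\mid p_n$, so that $r=0$ and $Q_n^{(N)}$ is a polynomial in $z^{2N+1}$. -/

import Mathlib

noncomputable section

open Polynomial

namespace PainleveTwo

/-- Differential polynomials over `ℂ` in one dependent variable `u`: the variable `X j` stands for
the `j`-th derivative of `u`. -/
abbrev DiffPoly : Type := MvPolynomial ℕ ℂ

/-- The total derivative `d/dz` on differential polynomials: `u_j ↦ u_{j+1}`. -/
def dz : Derivation ℂ DiffPoly DiffPoly :=
  MvPolynomial.mkDerivation ℂ (fun j => MvPolynomial.X (j + 1))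

/-- `u` and `u_z` as differential polynomials. -/
abbrev u₀ : DiffPoly := MvPolynomial.X 0

abbrev u₁ : DiffPoly := MvPolynomial.X 1

/-- The Lenard recursion `d_z L_{N+1} = (d_z³ + 4 u d_z + 2 u_z) L_N`, `L_0 = 1/2`, with vanishing
integration constants. -/
structure IsLenard (L : ℕ → DiffPoly) : Prop where
  zero : L 0 = MvPolynomial.C (1 / 2)
  succ : ∀ N, dz (L (N + 1)) = dz (dz (dz (L N))) + 4 * u₀ * dz (L N) + 2 * u₁ * L N
  const : ∀ N, MvPolynomial.constantCoeff (L (N + 1)) = 0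

/-! ### The Lenard recursion has exactly one solution -/

/-- Explicit solution of the Lenard recursion (its quadratic first integral). -/
def lenardAux : ℕ → DiffPoly
  | 0 => MvPolynomial.C (1 / 2)
  | N + 1 =>
    (∑ i : Fin (N + 1), (2 * lenardAux i * dz (dz (lenardAux (N - i)))
        - dz (lenardAux i) * dz (lenardAux (N - i)) + 4 * u₀ * lenardAux i * lenardAux (N - i)))
      - ∑ i : Fin N, lenardAux (i + 1) * lenardAux (N - i)
  decreasing_by all_goals omega

theorem constantCoeff_dz (P : DiffPoly) : MvPolynomial.constantCoeff (dz P) = 0 := by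
  induction P using MvPolynomial.induction_on with
  | C a => simp [dz]
  | add p q hp hq => simp [hp, hq]
  | mul_X p n hp => simp [dz] at hp ⊢

theorem constantCoeff_lenardAux (N : ℕ) :
    MvPolynomial.constantCoeff (lenardAux (N + 1)) = 0 := by
  induction N using Nat.strong_induction_on with
  | _ N ih =>
    rw [lenardAux]
    simp only [map_sub, map_sum, map_add, map_mul, constantCoeff_dz]
    have : ∀ i : Fin N, MvPolynomial.constantCoeff (lenardAux (i + 1)) = 0 := fun i => ih i i.2
    simp [this]

theorem lenardAux_quadratic (N : ℕ) :
    ∑ p ∈ Finset.HasAntidiagonal.antidiagonal (N + 1), lenardAux p.1 * lenardAux p.2 =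
      ∑ p ∈ Finset.HasAntidiagonal.antidiagonal N, (2 * lenardAux p.1 * dz (dz (lenardAux p.2))
        - dz (lenardAux p.1) * dz (lenardAux p.2)
        + 4 * u₀ * lenardAux p.1 * lenardAux p.2) := by
  rw [Finset.Nat.sum_antidiagonal_eq_sum_range_succ_mk,
    Finset.Nat.sum_antidiagonal_eq_sum_range_succ_mk, Finset.sum_range_succ,
    Finset.sum_range_succ']
  have h0 : lenardAux 0 = MvPolynomial.C (1 / 2) := by rw [lenardAux]
  have h2 : (MvPolynomial.C (1 / 2) : DiffPoly) + MvPolynomial.C (1 / 2) = 1 := by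
    rw [← map_add]; norm_num
  have h := lenardAux.eq_2 N
  rw [← Fin.sum_univ_eq_sum_range (fun i => 2 * lenardAux i * dz (dz (lenardAux (N - i)))
        - dz (lenardAux i) * dz (lenardAux (N - i)) + 4 * u₀ * lenardAux i * lenardAux (N - i)),
    ← Fin.sum_univ_eq_sum_range (fun i => lenardAux (i + 1) * lenardAux (N + 1 - (i + 1)))]
  simp only [Nat.add_sub_add_right, Nat.sub_zero, Nat.sub_self, h0]
  linear_combination h + lenardAux (N + 1) * h2

theorem lenardAux_succ (N : ℕ) :
    dz (lenardAux (N + 1)) = dz (dz (dz (lenardAux N))) + 4 * u₀ * dz (lenardAux N)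
      + 2 * u₁ * lenardAux N := by
  set E : ℕ → DiffPoly := fun N => dz (lenardAux (N + 1)) - (dz (dz (dz (lenardAux N)))
    + 4 * u₀ * dz (lenardAux N) + 2 * u₁ * lenardAux N) with hE
  have hu : dz u₀ = u₁ := by simp [dz]
  have hL0 : dz (lenardAux 0) = 0 := by rw [lenardAux]; simp [dz]
  have sw : ∀ (F : ℕ → ℕ → DiffPoly) (n : ℕ),
      ∑ p ∈ Finset.HasAntidiagonal.antidiagonal n, F p.1 p.2 = ∑ p ∈ Finset.HasAntidiagonal.antidiagonal n, F p.2 p.1 :=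
    fun F n => (Finset.Nat.sum_antidiagonal_swap (f := fun p => F p.1 p.2)).symm
  have key : ∀ n, ∑ p ∈ Finset.HasAntidiagonal.antidiagonal n, lenardAux p.1 * E p.2 = 0 := by
    intro n
    have h := congrArg dz (lenardAux_quadratic n)
    simp only [map_sum, map_add, map_sub, Derivation.leibniz, smul_eq_mul] at h
    have e2 : dz (2 : DiffPoly) = 0 := by
      simpa using Derivation.map_natCast dz 2
    have e4 : dz (4 : DiffPoly) = 0 := by
      simpa using Derivation.map_natCast dz 4
    simp only [e2, e4, hu, mul_zero, add_zero, Finset.sum_add_distrib, Finset.sum_sub_distrib] at h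
    rw [sw (fun i j => lenardAux j * dz (lenardAux i)) (n + 1),
      Finset.Nat.sum_antidiagonal_succ'] at h
    simp only [hL0, mul_zero] at h
    have s1 := sw (fun i j => dz (dz (lenardAux j)) * dz (lenardAux i)) n
    have s2 := sw (fun i j => lenardAux j * (4 * u₀ * dz (lenardAux i))) n
    have hEsum : ∑ p ∈ Finset.HasAntidiagonal.antidiagonal n, lenardAux p.1 * E p.2 =
        ∑ p ∈ Finset.HasAntidiagonal.antidiagonal n, lenardAux p.1 * dz (lenardAux (p.2 + 1))
        - ∑ p ∈ Finset.HasAntidiagonal.antidiagonal n, lenardAux p.1 * dz (dz (dz (lenardAux p.2)))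
        - ∑ p ∈ Finset.HasAntidiagonal.antidiagonal n, lenardAux p.1 * (4 * u₀ * dz (lenardAux p.2))
        - ∑ p ∈ Finset.HasAntidiagonal.antidiagonal n, lenardAux p.1 * (2 * u₁ * lenardAux p.2) := by
      simp only [hE, ← Finset.sum_sub_distrib]
      exact Finset.sum_congr rfl fun p _ => by ring
    have t1 : ∑ p ∈ Finset.HasAntidiagonal.antidiagonal n, 2 * lenardAux p.1 * dz (dz (dz (lenardAux p.2))) =
        2 * ∑ p ∈ Finset.HasAntidiagonal.antidiagonal n, lenardAux p.1 * dz (dz (dz (lenardAux p.2))) := by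
      rw [Finset.mul_sum]; exact Finset.sum_congr rfl fun p _ => by ring
    have t2 : ∑ p ∈ Finset.HasAntidiagonal.antidiagonal n, dz (dz (lenardAux p.2)) * (2 * dz (lenardAux p.1)) =
        2 * ∑ p ∈ Finset.HasAntidiagonal.antidiagonal n, dz (dz (lenardAux p.2)) * dz (lenardAux p.1) := by
      rw [Finset.mul_sum]; exact Finset.sum_congr rfl fun p _ => by ring
    have t3 : ∑ p ∈ Finset.HasAntidiagonal.antidiagonal n, dz (lenardAux p.1) * dz (dz (lenardAux p.2)) =
        ∑ p ∈ Finset.HasAntidiagonal.antidiagonal n, dz (dz (lenardAux p.2)) * dz (lenardAux p.1) :=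
      Finset.sum_congr rfl fun p _ => by ring
    have t4 : ∑ p ∈ Finset.HasAntidiagonal.antidiagonal n, dz (lenardAux p.2) * dz (dz (lenardAux p.1)) =
        ∑ p ∈ Finset.HasAntidiagonal.antidiagonal n, dz (dz (lenardAux p.1)) * dz (lenardAux p.2) :=
      Finset.sum_congr rfl fun p _ => by ring
    have t5 : ∑ p ∈ Finset.HasAntidiagonal.antidiagonal n, 4 * u₀ * lenardAux p.1 * dz (lenardAux p.2) =
        ∑ p ∈ Finset.HasAntidiagonal.antidiagonal n, lenardAux p.1 * (4 * u₀ * dz (lenardAux p.2)) :=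
      Finset.sum_congr rfl fun p _ => by ring
    have t6 : ∑ p ∈ Finset.HasAntidiagonal.antidiagonal n, lenardAux p.2 * (4 * u₀ * dz (lenardAux p.1) + lenardAux p.1 * (4 * u₁)) =
        ∑ p ∈ Finset.HasAntidiagonal.antidiagonal n, lenardAux p.2 * (4 * u₀ * dz (lenardAux p.1))
        + 2 * ∑ p ∈ Finset.HasAntidiagonal.antidiagonal n, lenardAux p.1 * (2 * u₁ * lenardAux p.2) := by
      rw [Finset.mul_sum, ← Finset.sum_add_distrib]
      exact Finset.sum_congr rfl fun p _ => by ring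
    refine (mul_eq_zero.mp ?_).resolve_left (two_ne_zero (α := DiffPoly))
    linear_combination 2 * hEsum + h + t1 + t2 - t3 - t4 + t5 + t6 + s1 + s2
  have hz : ∀ n, E n = 0 := by
    intro n
    induction n using Nat.strong_induction_on with
    | _ n ih =>
      have h := key n
      rw [Finset.sum_eq_single (0, n)] at h
      · have h0 : lenardAux 0 ≠ 0 := by rw [lenardAux]; simp
        exact (mul_eq_zero.mp h).resolve_left h0
      · rintro ⟨i, j⟩ hij hne
        rw [Finset.HasAntidiagonal.mem_antidiagonal] at hij
        simp only at hij
        have : i ≠ 0 := by rintro rfl; apply hne; simp at hij; simp [hij]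
        simp [ih j (by omega)]
      · simp
  exact sub_eq_zero.mp (hz N)

theorem isLenard_lenardAux : IsLenard lenardAux :=
  ⟨by rw [lenardAux], lenardAux_succ, constantCoeff_lenardAux⟩

/-- The only differential polynomials with zero total derivative are the constants. -/
theorem eq_C_of_dz_eq_zero (P : DiffPoly) (h : dz P = 0) :
    P = MvPolynomial.C (MvPolynomial.constantCoeff P) := by
  have comm : ∀ (k : ℕ) (Q : DiffPoly), MvPolynomial.pderiv (k + 1) (dz Q) =
      dz (MvPolynomial.pderiv (k + 1) Q) + MvPolynomial.pderiv k Q := by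
    intro k Q
    induction Q using MvPolynomial.induction_on with
    | C a => simp [dz]
    | add p q hp hq => simp only [map_add, hp, hq]; ring
    | mul_X p n hp =>
      have hX : MvPolynomial.pderiv (k + 1) (dz (MvPolynomial.X n)) =
          MvPolynomial.pderiv k (MvPolynomial.X n : DiffPoly) := by
        by_cases hkn : n = k
        · subst hkn; simp [dz]
        · simp [dz, MvPolynomial.pderiv_X_of_ne hkn,
            MvPolynomial.pderiv_X_of_ne (show n + 1 ≠ k + 1 by omega)]
      have hX' : dz (MvPolynomial.pderiv (k + 1) (MvPolynomial.X n : DiffPoly)) = 0 := by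
        by_cases hkn : n = k + 1
        · subst hkn; simp
        · simp [MvPolynomial.pderiv_X_of_ne hkn]
      simp only [Derivation.leibniz, smul_eq_mul, map_add, hp, hX, hX']
      ring
  have hp : ∀ k, MvPolynomial.pderiv k P = 0 := by
    obtain ⟨K, hK⟩ : ∃ K, ∀ k, K ≤ k → MvPolynomial.pderiv k P = 0 := by
      refine ⟨P.vars.sup id + 1, fun k hk => MvPolynomial.pderiv_eq_zero_of_notMem_vars ?_⟩
      intro hmem
      have : k ≤ P.vars.sup id := Finset.le_sup (f := id) hmem
      omega
    have down : ∀ d k, K ≤ k + d → MvPolynomial.pderiv k P = 0 := by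
      intro d
      induction d with
      | zero => exact fun k hk => hK k hk
      | succ d ih =>
        intro k hk
        have := comm k P
        rw [h, ih (k + 1) (by omega)] at this
        simpa using this.symm
    exact fun k => down K k (by omega)
  ext m
  rw [MvPolynomial.coeff_C]
  split_ifs with hm
  · subst hm; rfl
  · obtain ⟨k, hk⟩ : ∃ k, m k ≠ 0 := by
      by_contra hcon
      push Not at hcon
      exact hm (Finsupp.ext fun k => (hcon k).symm)
    have h1 := MvPolynomial.coeff_pderiv (i := k) P (m - Finsupp.single k 1)
    have h2 : m - Finsupp.single k 1 + Finsupp.single k 1 = m :=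
      tsub_add_cancel_of_le (by simpa [Finsupp.single_le_iff] using Nat.one_le_iff_ne_zero.mpr hk)
    rw [hp k, h2] at h1
    have h3 : ((m - Finsupp.single k 1 : ℕ →₀ ℕ) k : ℂ) + 1 ≠ 0 := Nat.cast_add_one_ne_zero _
    exact (mul_eq_zero.mp h1.symm).resolve_right h3

theorem existsUnique_isLenard : ∃! L : ℕ → DiffPoly, IsLenard L := by
  refine ⟨lenardAux, isLenard_lenardAux, fun L hL => ?_⟩
  funext N
  induction N with
  | zero => rw [hL.zero, isLenard_lenardAux.zero]
  | succ N ih =>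
    have h := eq_C_of_dz_eq_zero (L (N + 1) - lenardAux (N + 1)) (by
      rw [map_sub, hL.succ, isLenard_lenardAux.succ, ih, sub_self])
    rw [map_sub, hL.const, isLenard_lenardAux.const] at h
    simpa [sub_eq_zero] using h

/-- The differential polynomials `L_N[u]` given by the Lenard recursion. -/
def lenard : ℕ → DiffPoly := existsUnique_isLenard.choose

theorem isLenard_lenard : IsLenard lenard := existsUnique_isLenard.choose_spec.1

/-! ### The second Painlevé hierarchy -/

/-- The value of `L_N[u]` at an element `u` of a `ℂ`-algebra with differentiation `D`. -/
def lenardEval {A : Type*} [CommRing A] [Algebra ℂ A] (D : A → A) (N : ℕ) (u : A) : A :=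
  MvPolynomial.aeval (fun j => D^[j] u) (lenard N)

/-- The left-hand side `P₂^{(N)}[w, α] = (d/dz + 2w) L_N[w' - w²] - z w - α` of the `N`-th equation
of the second Painlevé hierarchy, in a `ℂ`-algebra with differentiation `D` and
independent variable `z`. -/
def P2 {A : Type*} [CommRing A] [Algebra ℂ A] (D : A → A) (z : A) (N : ℕ) (w : A) (α : ℂ) : A :=
  D (lenardEval D N (D w - w ^ 2)) + 2 * w * lenardEval D N (D w - w ^ 2) - z * w
    - algebraMap ℂ A α

/-- The derivative `d/dz` of a rational function of `z` (quotient rule). -/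
def ratDeriv (f : RatFunc ℂ) : RatFunc ℂ :=
  algebraMap ℂ[X] (RatFunc ℂ) (derivative f.num * f.denom - f.num * derivative f.denom) /
    algebraMap ℂ[X] (RatFunc ℂ) (f.denom ^ 2)

/-- The rational function `w` solves `P₂^{(N)}[w, α] = 0`. -/
def IsRationalSolution (N : ℕ) (α : ℂ) (w : RatFunc ℂ) : Prop :=
  P2 ratDeriv RatFunc.X N w α = 0

/-- The logarithmic derivative `Q'/Q` of a polynomial. -/
def polyLogDeriv (Q : ℂ[X]) : RatFunc ℂ :=
  algebraMap ℂ[X] (RatFunc ℂ) (derivative Q) / algebraMap ℂ[X] (RatFunc ℂ) Q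

/-- `IsYablonskiiVorobev N n Q`: the polynomial `Q` is `Q_n^{(N)}`. Here `Q_0 = 1`, and `Q_{n+1}` is
the monic polynomial for which `w = d/dz ln (Q_n / Q_{n+1})` is a rational solution of
`P₂^{(N)}[w, n + 1] = 0`. -/
inductive IsYablonskiiVorobev (N : ℕ) : ℕ → ℂ[X] → Prop
  | zero : IsYablonskiiVorobev N 0 1
  | succ {n : ℕ} {P Q : ℂ[X]} : IsYablonskiiVorobev N n P → Q.Monic →
      IsRationalSolution N ((n + 1 : ℕ) : ℂ) (polyLogDeriv P - polyLogDeriv Q) →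
      IsYablonskiiVorobev N (n + 1) Q

/-! ### Expansions at infinity: Laurent series in `t = 1/z` -/

/-- The derivative `d/dz = -t² d/dt` on Laurent series in `t = 1/z`. -/
def dInf (f : LaurentSeries ℂ) : LaurentSeries ℂ :=
  -(HahnSeries.single (2 : ℤ) (1 : ℂ) * LaurentSeries.derivative ℂ f)

/-- The variable `z = t⁻¹` as a Laurent series in `t = 1/z`. -/
def zInf : LaurentSeries ℂ := HahnSeries.single (-1 : ℤ) (1 : ℂ)

/-- The series `∑_{m ≥ 0} c_m z^{-m-1}`, as a Laurent series in `t = 1/z`. -/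
def seriesAtInfinity (c : ℕ → ℂ) : LaurentSeries ℂ :=
  HahnSeries.single (1 : ℤ) (1 : ℂ) * HahnSeries.ofPowerSeries ℤ ℂ (PowerSeries.mk c)

/-- The series `∑_{m ≥ 0} c_m z^{-m-1}` satisfies `P₂^{(N)}[w, α] = 0`; thus `c m` is the
coefficient of `z^{-(m+1)}`. -/
def IsExpansionAtInfinity (N : ℕ) (α : ℂ) (c : ℕ → ℂ) : Prop :=
  P2 dInf zInf N (seriesAtInfinity c) α = 0

end PainleveTwo

end

noncomputable section

open Polynomial

namespace PainleveTwo

/-! Everything rests on a weight count. Give `1/z` weight 1 and let `d/dz` raise the weight by 1.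
The explicit quadratic formula behind `lenardAux` shows that `L_N[u]` has weight `2N` when `u` has
weight 2, so the nonlinear part `(d/dz + 2w) L_N[w' - w²]` has weight `2N + 1` when `w` has weight
1. Comparing coefficients of `z^{-m}` then expresses `c_m` through the `c_i` with `i ≤ m - 2N - 1`,
plus `-α` when `m = 0`. Such a system has exactly one solution, and it inherits the support on
multiples of `2N + 1` (`existsUnique_isExpansionAtInfinity`).

The field `ℂ(z)` embeds in `ℂ((1/z))` compatibly with differentiation, and `Q'/Q` expands as `∑ s_m
z^{-m-1}` with `s_m` the power sums of the roots of `Q`. A rational solution `P'/P - Q'/Q` therefore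
has the unique formal solution as its expansion, and summing over `i ≤ n` telescopes to `s_{n,m} =
-∑ c_{i,-(m+1)}` (`IsYablonskiiVorobev.powerSum_roots`). For `α = 1` the solution is `-1/z`, so `i =
1` matters only for `m = 0`.

In characteristic zero Newton's identities recover a monic polynomial from its power sums
(`newton_iff`). This gives uniqueness and the formula for the coefficients, and carries the
vanishing of `s_{n,m}` off the multiples of `2N + 1` over to them. -/

theorem lenard_eq_lenardAux : lenard = lenardAux :=
  existsUnique_isLenard.unique isLenard_lenard isLenard_lenardAux

/-! ### Evaluation of differential polynomials -/

section Eval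

variable {A : Type*} [CommRing A] [Algebra ℂ A]

/-- Evaluation of differential polynomials intertwines the total derivative with a derivation. -/
theorem aeval_dz (D : Derivation ℂ A A) (u : A) (P : DiffPoly) :
    MvPolynomial.aeval (fun j => D^[j] u) (dz P) = D (MvPolynomial.aeval (fun j => D^[j] u) P) := by
  induction P using MvPolynomial.induction_on with
  | C a => simp [dz]
  | add p q hp hq => simp only [map_add, hp, hq]
  | mul_X p n hp =>
    have hX : dz (MvPolynomial.X n) = MvPolynomial.X (n + 1) := by simp [dz]
    simp only [Derivation.leibniz, map_add, smul_eq_mul, map_mul, hp, hX, MvPolynomial.aeval_X,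
      Function.iterate_succ_apply']

/-- An additive map that obeys the Leibniz rule and kills the constants, as a derivation. -/
def derivationOfLeibniz (D : A → A) (hadd : ∀ f g, D (f + g) = D f + D g)
    (hmul : ∀ f g, D (f * g) = f * D g + g * D f) (hconst : ∀ a : ℂ, D (algebraMap ℂ A a) = 0) :
    Derivation ℂ A A :=
  Derivation.mk'
    { toFun := D
      map_add' := hadd
      map_smul' := fun a f => by
        simp only [Algebra.smul_def, RingHom.id_apply, hmul, hconst, mul_zero, add_zero] }
    hmul

/-- An `ℕ`-graded binary relation compatible with the operations of a differential algebra. -/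
structure IsGradedRel (D : A → A) (R : ℕ → A → A → Prop) : Prop where
  const : ∀ a : ℂ, R 0 (algebraMap ℂ A a) (algebraMap ℂ A a)
  zero : ∀ i, R i 0 0
  add : ∀ {i f f' g g'}, R i f f' → R i g g' → R i (f + g) (f' + g')
  sub : ∀ {i f f' g g'}, R i f f' → R i g g' → R i (f - g) (f' - g')
  mul : ∀ {i j f f' g g'}, R i f f' → R j g g' → R (i + j) (f * g) (f' * g')
  deriv : ∀ {i f f'}, R i f f' → R (i + 1) (D f) (D f')

namespace IsGradedRel

theorem ofNat {D : A → A} {R : ℕ → A → A → Prop} (hR : IsGradedRel D R) (n : ℕ) [n.AtLeastTwo] :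
    R 0 (OfNat.ofNat n) (OfNat.ofNat n) := by
  have h := hR.const (OfNat.ofNat n)
  rwa [map_ofNat] at h

theorem sum {D : A → A} {R : ℕ → A → A → Prop} (hR : IsGradedRel D R) {i : ℕ} {ι : Type*}
    (s : Finset ι) (f g : ι → A) (h : ∀ a ∈ s, R i (f a) (g a)) :
    R i (∑ a ∈ s, f a) (∑ a ∈ s, g a) := by
  classical
  induction s using Finset.induction_on with
  | empty => simpa using hR.zero i
  | insert a s ha ih =>
    rw [Finset.sum_insert ha, Finset.sum_insert ha]
    exact hR.add (h a (by simp)) (ih fun b hb => h b (by simp [hb]))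

/-- `L_N` has weight `2 N` when `u` has weight `2` and differentiation has weight `1`. -/
theorem lenardEval (D : Derivation ℂ A A) {R : ℕ → A → A → Prop} (hR : IsGradedRel D R)
    {u v : A} (h : R 2 u v) (N : ℕ) :
    R (2 * N) (lenardEval D N u) (lenardEval D N v) := by
  -- The Lenard recursion only gives the derivative of `L_{N+1}`; the integrated formula is
  -- algebraic in the earlier `L_i`, so the weight follows by induction.
  simp only [PainleveTwo.lenardEval, lenard_eq_lenardAux]
  induction N using Nat.strong_induction_on with
  | _ N ih =>
    cases N with
    | zero =>
      rw [lenardAux]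
      simpa using hR.const (1 / 2)
    | succ N =>
      rw [lenardAux]
      simp only [map_sub, map_sum, map_add, map_mul, aeval_dz, map_ofNat, MvPolynomial.aeval_X,
        Function.iterate_zero, id]
      refine hR.sub (hR.sum _ _ _ fun i _ => ?_) (hR.sum _ _ _ fun i _ => ?_)
      · have hi := i.2
        have h1 := ih i (by omega)
        have h2 := ih (N - i) (by omega)
        refine hR.add (hR.sub ?_ ?_) ?_
        · convert hR.mul (hR.mul (hR.ofNat 2) h1) (hR.deriv (hR.deriv h2)) using 1
          omega
        · convert hR.mul (hR.deriv h1) (hR.deriv h2) using 1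
          omega
        · convert hR.mul (hR.mul (hR.mul (hR.ofNat 4) h) h1) h2 using 1
          omega
      · have hi := i.2
        convert hR.mul (ih (i + 1) (by omega)) (ih (N - i) (by omega)) using 1
        omega

/-- The nonlinear part of `P₂^{(N)}` has weight `2 N + 1` when `w` has weight `1`. -/
theorem nonlinear (D : Derivation ℂ A A) {R : ℕ → A → A → Prop} (hR : IsGradedRel D R)
    {w w' : A} (h : R 1 w w') (N : ℕ) :
    R (2 * N + 1)
      (D (PainleveTwo.lenardEval D N (D w - w ^ 2)) +
        2 * w * PainleveTwo.lenardEval D N (D w - w ^ 2))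
      (D (PainleveTwo.lenardEval D N (D w' - w' ^ 2)) +
        2 * w' * PainleveTwo.lenardEval D N (D w' - w' ^ 2)) := by
  have hu : R 2 (D w - w ^ 2) (D w' - w' ^ 2) := by
    rw [sq, sq]
    exact hR.sub (hR.deriv h) (hR.mul h h)
  have hL := hR.lenardEval D hu N
  refine hR.add (hR.deriv hL) ?_
  convert hR.mul (hR.mul (hR.ofNat 2) h) hL using 1
  omega

end IsGradedRel

/-- `L_N` is a polynomial in the iterates of `D`, so intertwining suffices: neither `D` nor `D'` has
to obey a Leibniz rule. -/
theorem map_P2 {B : Type*} [CommRing B] [Algebra ℂ B] (φ : A →ₐ[ℂ] B) {D : A → A} {D' : B → B}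
    (hφ : ∀ f, φ (D f) = D' (φ f)) (z : A) (N : ℕ) (w : A) (α : ℂ) :
    φ (P2 D z N w α) = P2 D' (φ z) N (φ w) α := by
  have hL : ∀ u, φ (lenardEval D N u) = lenardEval D' N (φ u) := by
    intro u
    simp only [lenardEval, MvPolynomial.comp_aeval_apply]
    congr 2
    funext j
    exact (Function.Semiconj.iterate_right hφ j).eq u
  simp only [P2, map_sub, map_add, map_mul, hL, hφ, map_ofNat, AlgHom.commutes, map_pow]

theorem lenardEval_zero (D : Derivation ℂ A A) {N : ℕ} (hN : 1 ≤ N) : lenardEval D N 0 = 0 := by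
  obtain ⟨N, rfl⟩ := Nat.exists_eq_add_of_le' hN
  have h : (fun j => (⇑D)^[j] (0 : A)) = 0 := by
    funext j
    induction j with
    | zero => rfl
    | succ j ih => rw [Function.iterate_succ_apply', ih]; simp
  rw [lenardEval, h, MvPolynomial.aeval_zero, isLenard_lenard.const, map_zero]

end Eval

/-! ### Differentiation of series at infinity -/

theorem coeff_dInf (f : LaurentSeries ℂ) (k : ℤ) :
    (dInf f).coeff k = -((k - 1 : ℤ) : ℂ) * f.coeff (k - 1) := by
  have h : k - 2 + ((1 : ℕ) : ℤ) = k - 1 := by push_cast; ring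
  rw [dInf, HahnSeries.coeff_neg, HahnSeries.coeff_single_mul, LaurentSeries.derivative_apply,
    LaurentSeries.hasseDeriv_coeff, h, Ring.choose_one_right, zsmul_eq_mul]
  ring

/-- The Euler derivation `t d/dt` on Laurent series in `t`. -/
def euler (f : LaurentSeries ℂ) : LaurentSeries ℂ where
  coeff k := (k : ℂ) * f.coeff k
  isPWO_support' := f.isPWO_support.mono fun k hk => by
    simp only [Function.mem_support] at hk
    exact right_ne_zero_of_mul hk

theorem support_euler_subset (f : LaurentSeries ℂ) : (euler f).support ⊆ f.support := by
  intro k hk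
  exact right_ne_zero_of_mul (HahnSeries.mem_support _ _ |>.mp hk)

/-- The Euler operator is diagonal in the powers of `t`, so its Leibniz rule reduces to `k = i + j`
in each convolution term; that of `dInf` follows through `dInf_eq_euler`. -/
theorem euler_mul (f g : LaurentSeries ℂ) : euler (f * g) = f * euler g + euler f * g := by
  ext k
  -- All three convolutions are put on the supports of `f` and `g`, although an Euler derivative may
  -- have smaller support.
  rw [HahnSeries.coeff_add,
    HahnSeries.coeff_mul_right' g.isPWO_support (support_euler_subset g),
    HahnSeries.coeff_mul_left' f.isPWO_support (support_euler_subset f)]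
  simp only [euler, HahnSeries.coeff_mul]
  rw [Finset.mul_sum, ← Finset.sum_add_distrib]
  refine Finset.sum_congr rfl fun p hp => ?_
  have hk : p.1 + p.2 = k := by simpa using (Finset.mem_antidiagonal.mp hp).2.2
  rw [← hk]
  push_cast
  ring

theorem dInf_eq_euler (f : LaurentSeries ℂ) :
    dInf f = -(HahnSeries.single (1 : ℤ) (1 : ℂ) * euler f) := by
  ext k
  rw [coeff_dInf, HahnSeries.coeff_neg, HahnSeries.coeff_single_mul, euler]
  ring

theorem dInf_add (f g : LaurentSeries ℂ) : dInf (f + g) = dInf f + dInf g := by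
  ext k
  simp only [coeff_dInf, HahnSeries.coeff_add]
  ring

theorem dInf_mul (f g : LaurentSeries ℂ) : dInf (f * g) = f * dInf g + g * dInf f := by
  simp only [dInf_eq_euler, euler_mul]
  ring

theorem dInf_algebraMap (a : ℂ) : dInf (algebraMap ℂ (LaurentSeries ℂ) a) = 0 := by
  ext k
  rw [coeff_dInf, LaurentSeries.algebraMap_apply, HahnSeries.C_apply]
  by_cases hk : k - 1 = 0
  · simp [hk]
  · simp [HahnSeries.coeff_single_of_ne hk]

/-- `d/dz` on Laurent series in `1/z`, as a derivation. -/
def dInfDerivation :=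
  derivationOfLeibniz dInf dInf_add dInf_mul dInf_algebraMap

theorem coe_dInfDerivation : ⇑dInfDerivation = dInf := rfl

/-- The Laurent series in `t` supported on the exponents `g, g + M, g + 2 M, …`. -/
def gradedTail (M g : ℤ) : AddSubgroup (LaurentSeries ℂ) where
  carrier := {f | ∀ k, f.coeff k ≠ 0 → g ≤ k ∧ M ∣ k - g}
  zero_mem' := by simp
  add_mem' := by
    intro f f' hf hf' k hk
    rw [HahnSeries.coeff_add] at hk
    by_cases h : f.coeff k = 0
    · exact hf' k (by simpa [h] using hk)
    · exact hf k h
  neg_mem' := by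
    intro f hf k hk
    rw [HahnSeries.coeff_neg, neg_ne_zero] at hk
    exact hf k hk

theorem mul_mem_gradedTail {M a b : ℤ} {f g : LaurentSeries ℂ} (hf : f ∈ gradedTail M a)
    (hg : g ∈ gradedTail M b) : f * g ∈ gradedTail M (a + b) := by
  intro k hk
  rw [HahnSeries.coeff_mul] at hk
  obtain ⟨p, hp, hne⟩ := Finset.exists_ne_zero_of_sum_ne_zero hk
  have hk : p.1 + p.2 = k := by simpa using (Finset.mem_antidiagonal.mp hp).2.2
  obtain ⟨h1, h2⟩ := hf _ (left_ne_zero_of_mul hne)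
  obtain ⟨h3, h4⟩ := hg _ (right_ne_zero_of_mul hne)
  refine ⟨by omega, ?_⟩
  have : k - (a + b) = (p.1 - a) + (p.2 - b) := by rw [← hk]; ring
  rw [this]
  exact dvd_add h2 h4

theorem dInf_mem_gradedTail {M a : ℤ} {f : LaurentSeries ℂ} (hf : f ∈ gradedTail M a) :
    dInf f ∈ gradedTail M (a + 1) := by
  intro k hk
  rw [coeff_dInf] at hk
  obtain ⟨h1, h2⟩ := hf _ (right_ne_zero_of_mul hk)
  refine ⟨by omega, ?_⟩
  convert h2 using 1
  ring

theorem algebraMap_mem_gradedTail (M : ℤ) (a : ℂ) :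
    algebraMap ℂ (LaurentSeries ℂ) a ∈ gradedTail M 0 := by
  intro k hk
  have : k = 0 := by
    by_contra h0
    rw [LaurentSeries.algebraMap_apply, HahnSeries.C_apply, HahnSeries.coeff_single_of_ne h0] at hk
    exact hk rfl
  simp [this]

/-! ### The formal solution at infinity -/

theorem coeff_seriesAtInfinity_succ (c : ℕ → ℂ) (m : ℕ) :
    (seriesAtInfinity c).coeff ((m : ℤ) + 1) = c m := by
  rw [seriesAtInfinity, HahnSeries.coeff_single_mul, add_sub_cancel_right, one_mul,
    HahnSeries.ofPowerSeries_apply_coeff, PowerSeries.coeff_mk]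

theorem coeff_seriesAtInfinity_of_lt (c : ℕ → ℂ) {k : ℤ} (hk : k < 1) :
    (seriesAtInfinity c).coeff k = 0 := by
  rw [seriesAtInfinity, HahnSeries.coeff_single_mul, one_mul, HahnSeries.ofPowerSeries_apply]
  refine HahnSeries.embDomain_of_notMem_range ?_
  rintro ⟨m, hm⟩
  have : (m : ℤ) = k - 1 := hm
  omega

theorem exists_of_coeff_seriesAtInfinity_ne_zero {c : ℕ → ℂ} {k : ℤ}
    (hk : (seriesAtInfinity c).coeff k ≠ 0) : ∃ m : ℕ, k = m + 1 ∧ c m ≠ 0 := by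
  have h1 : 1 ≤ k := by
    by_contra h
    exact hk (coeff_seriesAtInfinity_of_lt c (by omega))
  obtain ⟨m, rfl⟩ : ∃ m : ℕ, k = m + 1 := ⟨(k - 1).toNat, by omega⟩
  exact ⟨m, rfl, by rwa [coeff_seriesAtInfinity_succ] at hk⟩

/-- The nonlinear part `(d/dz + 2 w) L_N[w' - w²]` of `P₂^{(N)}` at the series with
coefficients `c`. -/
def nonlinearAtInfinity (N : ℕ) (c : ℕ → ℂ) : LaurentSeries ℂ :=
  dInf (lenardEval dInf N (dInf (seriesAtInfinity c) - seriesAtInfinity c ^ 2)) +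
    2 * seriesAtInfinity c *
      lenardEval dInf N (dInf (seriesAtInfinity c) - seriesAtInfinity c ^ 2)

/-- A predicate seen as a relation ignoring its second argument, so that one induction on `L_N`
serves both this support statement and the congruence below. -/
theorem isGradedRel_gradedTail (M : ℤ) :
    IsGradedRel dInf (fun i f _ => f ∈ gradedTail M i) where
  const a := by simpa using algebraMap_mem_gradedTail M a
  zero _ := zero_mem _
  add h h' := add_mem h h'
  sub h h' := sub_mem h h'
  mul h h' := by push_cast; exact mul_mem_gradedTail h h'
  deriv h := by push_cast; exact dInf_mem_gradedTail h

/-- Equality up to relative order `K`. The orders of both series are carried along because `fg -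
f'g' = f(g - g') + (f - f')g'` needs them; the step 1 makes the divisibility condition vacuous. -/
theorem isGradedRel_congr (K : ℕ) :
    IsGradedRel dInf (fun i f g => f ∈ gradedTail 1 i ∧ g ∈ gradedTail 1 i ∧
      f - g ∈ gradedTail 1 ((i : ℤ) + K)) where
  const a := by
    refine ⟨?_, ?_, ?_⟩
    · simpa using algebraMap_mem_gradedTail 1 a
    · simpa using algebraMap_mem_gradedTail 1 a
    · rw [sub_self]; exact zero_mem _
  zero _ := by
    refine ⟨zero_mem _, zero_mem _, ?_⟩
    rw [sub_self]; exact zero_mem _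
  add h h' := by
    refine ⟨add_mem h.1 h'.1, add_mem h.2.1 h'.2.1, ?_⟩
    rw [add_sub_add_comm]
    exact add_mem h.2.2 h'.2.2
  sub h h' := by
    refine ⟨sub_mem h.1 h'.1, sub_mem h.2.1 h'.2.1, ?_⟩
    rw [sub_sub_sub_comm]
    exact sub_mem h.2.2 h'.2.2
  mul {i j f f' g g'} h h' := by
    push_cast
    refine ⟨mul_mem_gradedTail h.1 h'.1, mul_mem_gradedTail h.2.1 h'.2.1, ?_⟩
    have e : f * g - f' * g' = f * (g - g') + (f - f') * g' := by ring
    rw [e]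
    refine add_mem ?_ ?_
    · convert mul_mem_gradedTail h.1 h'.2.2 using 2
      ring
    · convert mul_mem_gradedTail h.2.2 h'.2.1 using 2
      ring
  deriv {i f f'} h := by
    push_cast
    refine ⟨dInf_mem_gradedTail h.1, dInf_mem_gradedTail h.2.1, ?_⟩
    have e : dInf f - dInf f' = dInf (f - f') := by
      rw [← coe_dInfDerivation, map_sub]
    rw [e]
    rw [add_right_comm]
    exact dInf_mem_gradedTail h.2.2

theorem nonlinearAtInfinity_mem_gradedTail (N : ℕ) {M : ℕ} {c : ℕ → ℂ}
    (hc : ∀ m, ¬ M ∣ m → c m = 0) :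
    nonlinearAtInfinity N c ∈ gradedTail M (2 * N + 1) := by
  have hw : seriesAtInfinity c ∈ gradedTail M ((1 : ℕ) : ℤ) := by
    intro k hk
    obtain ⟨m, rfl, hm⟩ := exists_of_coeff_seriesAtInfinity_ne_zero hk
    refine ⟨by push_cast; omega, ?_⟩
    have : M ∣ m := by
      by_contra h
      exact hm (hc m h)
    simpa using Int.natCast_dvd_natCast.mpr this
  exact_mod_cast (isGradedRel_gradedTail M).nonlinear dInfDerivation (w' := seriesAtInfinity c) hw N

theorem nonlinearAtInfinity_coeff_of_lt (N : ℕ) (c : ℕ → ℂ) {k : ℤ} (hk : k < 2 * N + 1) :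
    (nonlinearAtInfinity N c).coeff k = 0 := by
  by_contra h
  have := (nonlinearAtInfinity_mem_gradedTail N (M := 1) (c := c)
    (fun m hm => (hm (one_dvd m)).elim) k h).1
  omega

theorem nonlinearAtInfinity_coeff_congr (N : ℕ) {K : ℕ} {c c' : ℕ → ℂ}
    (h : ∀ i < K, c i = c' i) {k : ℤ} (hk : k < 2 * N + 1 + K) :
    (nonlinearAtInfinity N c).coeff k = (nonlinearAtInfinity N c').coeff k := by
  have hw : ∀ c : ℕ → ℂ, seriesAtInfinity c ∈ gradedTail 1 ((1 : ℕ) : ℤ) := by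
    intro c k hk
    obtain ⟨m, rfl, -⟩ := exists_of_coeff_seriesAtInfinity_ne_zero hk
    exact ⟨by push_cast; omega, one_dvd _⟩
  have hd : seriesAtInfinity c - seriesAtInfinity c' ∈ gradedTail 1 (((1 : ℕ) : ℤ) + K) := by
    intro k hk
    refine ⟨?_, one_dvd _⟩
    by_contra hlt
    apply hk
    rw [HahnSeries.coeff_sub]
    by_cases h1 : k < 1
    · rw [coeff_seriesAtInfinity_of_lt c h1, coeff_seriesAtInfinity_of_lt c' h1, sub_zero]
    · obtain ⟨m, rfl⟩ : ∃ m : ℕ, k = m + 1 := ⟨(k - 1).toNat, by omega⟩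
      rw [coeff_seriesAtInfinity_succ, coeff_seriesAtInfinity_succ, h m (by omega), sub_self]
  have key := ((isGradedRel_congr K).nonlinear dInfDerivation ⟨hw c, hw c', hd⟩ N).2.2
  by_contra hne
  have := (key k (by rw [HahnSeries.coeff_sub]; exact sub_ne_zero.mpr hne)).1
  push_cast at this
  omega

theorem coeff_zInf_mul (f : LaurentSeries ℂ) (k : ℤ) : (zInf * f).coeff k = f.coeff (k + 1) := by
  rw [zInf, HahnSeries.coeff_single_mul, one_mul, sub_neg_eq_add]

/-- Comparing coefficients turns `P₂^{(N)}[w, α] = 0` into a fixed point equation. -/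
theorem isExpansionAtInfinity_iff (N : ℕ) (α : ℂ) (c : ℕ → ℂ) :
    IsExpansionAtInfinity N α c ↔
      (fun m : ℕ => (nonlinearAtInfinity N c).coeff m - if m = 0 then α else 0) = c := by
  have h : ∀ k : ℤ, (P2 dInf zInf N (seriesAtInfinity c) α).coeff k =
      (nonlinearAtInfinity N c).coeff k - (seriesAtInfinity c).coeff (k + 1)
        - if k = 0 then α else 0 := by
    intro k
    have hα : (algebraMap ℂ (LaurentSeries ℂ) α).coeff k = if k = 0 then α else 0 := by
      rw [LaurentSeries.algebraMap_apply, HahnSeries.C_apply]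
      split_ifs with hk
      · rw [hk, HahnSeries.coeff_single_same]
      · rw [HahnSeries.coeff_single_of_ne hk]
    rw [P2, HahnSeries.coeff_sub, HahnSeries.coeff_sub, coeff_zInf_mul, hα]
    rfl
  constructor
  · intro hc
    funext m
    have hm := h m
    rw [show P2 dInf zInf N (seriesAtInfinity c) α = 0 from hc, coeff_seriesAtInfinity_succ] at hm
    simp only [HahnSeries.coeff_zero, Nat.cast_eq_zero] at hm
    linear_combination -hm
  · intro hc
    refine HahnSeries.ext (funext fun k => ?_)
    rw [h k]
    -- At positive powers of `z` every term vanishes, so only `k ≥ 0` carries information.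
    by_cases hk : k < 0
    · rw [nonlinearAtInfinity_coeff_of_lt N c (by omega),
        coeff_seriesAtInfinity_of_lt c (by omega), if_neg hk.ne]
      simp
    · obtain ⟨m, rfl⟩ : ∃ m : ℕ, k = m := ⟨k.toNat, by omega⟩
      have hm := congrFun hc m
      rw [coeff_seriesAtInfinity_succ]
      simp only [HahnSeries.coeff_zero, Nat.cast_eq_zero]
      linear_combination hm

/-- A map of sequences whose `m`-th output depends only on the earlier inputs has exactly one
fixed point, and the fixed point vanishes wherever the map preserves vanishing. -/
theorem exists_unique_fixedPoint {R : Type*} [Zero R] (F : (ℕ → R) → ℕ → R)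
    (hF : ∀ k c c', (∀ i < k, c i = c' i) → ∀ m ≤ k, F c m = F c' m) (Z : Set ℕ)
    (hZ : ∀ c, (∀ i ∈ Z, c i = 0) → ∀ i ∈ Z, F c i = 0) :
    ∃ c, F c = c ∧ (∀ c', F c' = c' → c' = c) ∧ ∀ i ∈ Z, c i = 0 := by
  -- Each application of `F` settles one more entry of the iterates of the zero sequence, so the
  -- entry `m` of the fixed point can be read off after `m + 1` iterations.
  have step : ∀ j, ∀ i < j, F^[j + 1] 0 i = F^[j] 0 i := by
    intro j
    induction j with
    | zero => intro i hi; omega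
    | succ j ih =>
      intro i hi
      have h := hF j _ _ ih i (by omega)
      rwa [← Function.iterate_succ_apply' F (j + 1), ← Function.iterate_succ_apply' F j] at h
  have stable : ∀ d i, F^[i + 1 + d] 0 i = F^[i + 1] 0 i := by
    intro d i
    induction d with
    | zero => rfl
    | succ d ih => rw [← ih]; exact step (i + 1 + d) i (by omega)
  have hfix : F (fun m => F^[m + 1] 0 m) = fun m => F^[m + 1] 0 m := by
    funext m
    rw [Function.iterate_succ_apply' F m]
    refine hF m _ _ (fun i hi => ?_) m le_rfl
    have h := stable (m - (i + 1)) i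
    rw [Nat.add_sub_of_le hi] at h
    exact h.symm
  refine ⟨_, hfix, fun c' hc' => ?_, ?_⟩
  · funext m
    induction m using Nat.strong_induction_on with
    | _ m ih =>
      have h := hF m c' (fun m => F^[m + 1] 0 m) ih m le_rfl
      rwa [hc', hfix] at h
  · have hit : ∀ j, ∀ i ∈ Z, F^[j] 0 i = 0 := by
      intro j
      induction j with
      | zero => intro i _; rfl
      | succ j ih => rw [Function.iterate_succ_apply']; exact hZ _ ih
    exact fun i hi => hit (i + 1) i hi

theorem existsUnique_isExpansionAtInfinity (N : ℕ) (α : ℂ) :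
    ∃ c : ℕ → ℂ, IsExpansionAtInfinity N α c ∧
      (∀ c' : ℕ → ℂ, IsExpansionAtInfinity N α c' → c' = c) ∧
      c 0 = -α ∧ ∀ m : ℕ, ¬ (2 * N + 1) ∣ m → c m = 0 := by
  simp only [isExpansionAtInfinity_iff]
  obtain ⟨c, h1, h2, h3⟩ := exists_unique_fixedPoint
    (fun c (m : ℕ) => (nonlinearAtInfinity N c).coeff m - if m = 0 then α else 0)
    -- Agreement below `k` gives agreement of coefficients up to `k + 2N`, more than is needed.
    (fun k c c' h m hm => by
      rw [nonlinearAtInfinity_coeff_congr N h (by omega)])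
    {m | ¬ (2 * N + 1) ∣ m}
    (fun c hc m hm => by
      have hm : ¬ (2 * N + 1) ∣ m := hm
      have h0 : m ≠ 0 := by rintro rfl; exact hm (dvd_zero _)
      have hz : (nonlinearAtInfinity N c).coeff m = 0 := by
        by_contra hne
        obtain ⟨-, d, hd⟩ :=
          nonlinearAtInfinity_mem_gradedTail N (M := 2 * N + 1) (c := c) hc m hne
        apply hm
        rw [← Int.natCast_dvd_natCast]
        exact ⟨d + 1, by push_cast at hd ⊢; linear_combination hd⟩
      simp [hz, h0])
  refine ⟨c, h1, h2, ?_, h3⟩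
  have := congrFun h1 0
  simp only [Nat.cast_zero, if_true] at this
  rw [← this, nonlinearAtInfinity_coeff_of_lt N c (by omega), zero_sub]

theorem IsExpansionAtInfinity.unique {N : ℕ} {α : ℂ} {c c' : ℕ → ℂ}
    (h : IsExpansionAtInfinity N α c) (h' : IsExpansionAtInfinity N α c') : c = c' := by
  obtain ⟨d, -, hd, -⟩ := existsUnique_isExpansionAtInfinity N α
  rw [hd c h, hd c' h']

theorem IsExpansionAtInfinity.coeff_zero {N : ℕ} {α : ℂ} {c : ℕ → ℂ}
    (h : IsExpansionAtInfinity N α c) : c 0 = -α := by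
  obtain ⟨d, -, hd, h0, -⟩ := existsUnique_isExpansionAtInfinity N α
  rw [hd c h, h0]

theorem IsExpansionAtInfinity.eq_zero_of_not_dvd {N : ℕ} {α : ℂ} {c : ℕ → ℂ}
    (h : IsExpansionAtInfinity N α c) {m : ℕ} (hm : ¬ (2 * N + 1) ∣ m) : c m = 0 := by
  obtain ⟨d, -, hd, -, h0⟩ := existsUnique_isExpansionAtInfinity N α
  rw [hd c h, h0 m hm]

/-- For `α = 1` the formal solution is `w = -1/z`. -/
theorem isExpansionAtInfinity_one {N : ℕ} (hN : 1 ≤ N) :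
    IsExpansionAtInfinity N 1 (fun m => if m = 0 then -1 else 0) := by
  set c : ℕ → ℂ := fun m => if m = 0 then -1 else 0 with hc
  have hw : seriesAtInfinity c = HahnSeries.single (1 : ℤ) (-1 : ℂ) := by
    ext k
    by_cases h1 : k < 1
    · rw [coeff_seriesAtInfinity_of_lt c h1, HahnSeries.coeff_single_of_ne (by omega)]
    · obtain ⟨m, rfl⟩ : ∃ m : ℕ, k = m + 1 := ⟨(k - 1).toNat, by omega⟩
      rw [coeff_seriesAtInfinity_succ]
      by_cases hm : m = 0
      · subst hm; simp [hc]
      · rw [HahnSeries.coeff_single_of_ne (by omega)]; simp [hc, hm]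
  -- For `w = -1/z` both `w'` and `w²` equal `1/z²`.
  have hu : dInf (seriesAtInfinity c) - seriesAtInfinity c ^ 2 = 0 := by
    rw [hw, sq, HahnSeries.single_mul_single]
    ext k
    rw [HahnSeries.coeff_sub, coeff_dInf]
    by_cases hk : k = 2
    · subst hk; norm_num
    · rw [HahnSeries.coeff_single_of_ne (by omega), HahnSeries.coeff_single_of_ne (by omega)]
      simp
  have h0 : nonlinearAtInfinity N c = 0 := by
    rw [nonlinearAtInfinity, hu, ← coe_dInfDerivation, lenardEval_zero _ hN, map_zero, mul_zero,
      add_zero]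
  rw [isExpansionAtInfinity_iff, h0]
  funext m
  simp only [HahnSeries.coeff_zero, hc]
  split_ifs <;> simp

/-! ### Rational functions as series at infinity -/

theorem zInf_pow (n : ℕ) : zInf ^ n = HahnSeries.single (-(n : ℤ)) (1 : ℂ) := by
  induction n with
  | zero => simp
  | succ n ih =>
    rw [pow_succ, ih, zInf, HahnSeries.single_mul_single, mul_one, Nat.cast_succ, neg_add]

theorem coeff_aeval_zInf (p : ℂ[X]) (k : ℕ) : (aeval zInf p).coeff (-(k : ℤ)) = p.coeff k := by
  induction p using Polynomial.induction_on' with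
  | add p q hp hq => rw [map_add, HahnSeries.coeff_add, hp, hq, coeff_add]
  | monomial n a =>
    rw [aeval_monomial, LaurentSeries.algebraMap_apply, zInf_pow, HahnSeries.C_apply,
      HahnSeries.single_mul_single, zero_add, mul_one, coeff_monomial]
    split_ifs with h
    · rw [h, HahnSeries.coeff_single_same]
    · rw [HahnSeries.coeff_single_of_ne]
      omega

theorem aeval_zInf_injective : Function.Injective (aeval zInf : ℂ[X] →ₐ[ℂ] LaurentSeries ℂ) := by
  intro p q h
  ext k
  rw [← coeff_aeval_zInf, h, coeff_aeval_zInf]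

theorem aeval_zInf_ne_zero {p : ℂ[X]} (hp : p ≠ 0) : aeval zInf p ≠ 0 :=
  (map_ne_zero_iff _ aeval_zInf_injective).mpr hp

/-- The expansion at infinity of a rational function. -/
def expandAtInfinity : RatFunc ℂ →ₐ[ℂ] LaurentSeries ℂ :=
  RatFunc.liftAlgHom (aeval zInf)
    (nonZeroDivisors_le_comap_nonZeroDivisors_of_injective _ aeval_zInf_injective)

theorem expandAtInfinity_div (p q : ℂ[X]) :
    expandAtInfinity (algebraMap ℂ[X] (RatFunc ℂ) p / algebraMap ℂ[X] (RatFunc ℂ) q) =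
      aeval zInf p / aeval zInf q :=
  RatFunc.liftAlgHom_apply_div _ _ p q

theorem expandAtInfinity_X : expandAtInfinity RatFunc.X = zInf := by
  have h := expandAtInfinity_div X 1
  rwa [map_one, map_one, div_one, div_one, RatFunc.algebraMap_X, aeval_X] at h

theorem dInf_zInf : dInf zInf = 1 := by
  ext k
  rw [coeff_dInf, zInf, ← HahnSeries.single_zero_one]
  by_cases hk : k = 0
  · subst hk; norm_num
  · rw [HahnSeries.coeff_single_of_ne (by omega), HahnSeries.coeff_single_of_ne hk, mul_zero]

theorem dInf_aeval_zInf (p : ℂ[X]) : dInf (aeval zInf p) = aeval zInf (derivative p) := by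
  induction p using Polynomial.induction_on with
  | C a => rw [aeval_C, dInf_algebraMap, derivative_C, map_zero]
  | add p q hp hq => rw [map_add, dInf_add, hp, hq, derivative_add, map_add]
  | monomial n a h =>
    rw [pow_succ, ← mul_assoc, derivative_mul (f := C a * X ^ n), derivative_X, mul_one, map_add,
      map_mul, map_mul _ (derivative _), dInf_mul, h, aeval_X, dInf_zInf]
    ring

theorem dInf_div (f : LaurentSeries ℂ) {g : LaurentSeries ℂ} (hg : g ≠ 0) :
    dInf (f / g) = (dInf f * g - f * dInf g) / g ^ 2 := by
  have h := dInf_mul (f / g) g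
  rw [div_mul_cancel₀ f hg] at h
  rw [h]
  field_simp
  ring

theorem expandAtInfinity_ratDeriv (f : RatFunc ℂ) :
    expandAtInfinity (ratDeriv f) = dInf (expandAtInfinity f) := by
  have hf : expandAtInfinity f = aeval zInf f.num / aeval zInf f.denom := by
    rw [← expandAtInfinity_div, RatFunc.num_div_denom]
  have hd := aeval_zInf_ne_zero f.denom_ne_zero
  rw [ratDeriv, expandAtInfinity_div, hf, dInf_div _ hd, dInf_aeval_zInf, dInf_aeval_zInf]
  simp only [map_sub, map_mul, map_pow]

theorem seriesAtInfinity_add (c d : ℕ → ℂ) :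
    seriesAtInfinity (c + d) = seriesAtInfinity c + seriesAtInfinity d := by
  have h : PowerSeries.mk (c + d) = PowerSeries.mk c + PowerSeries.mk d := by
    ext m; simp
  rw [seriesAtInfinity, h, map_add, mul_add]
  rfl

theorem seriesAtInfinity_zero : seriesAtInfinity 0 = 0 := by
  simpa using seriesAtInfinity_add 0 0

theorem seriesAtInfinity_sub (c d : ℕ → ℂ) :
    seriesAtInfinity (c - d) = seriesAtInfinity c - seriesAtInfinity d := by
  rw [eq_sub_iff_add_eq, ← seriesAtInfinity_add, sub_add_cancel]

/-- The expansion `1/(z - a) = ∑ a^m z^{-m-1}`. -/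
theorem sub_mul_seriesAtInfinity_pow (a : ℂ) :
    (zInf - algebraMap ℂ (LaurentSeries ℂ) a) * seriesAtInfinity (fun m => a ^ m) = 1 := by
  ext k
  rw [sub_mul, HahnSeries.coeff_sub, coeff_zInf_mul, LaurentSeries.algebraMap_apply,
    HahnSeries.C_apply, HahnSeries.coeff_single_mul, sub_zero, ← HahnSeries.single_zero_one]
  rcases lt_trichotomy k 0 with hk | hk | hk
  · rw [coeff_seriesAtInfinity_of_lt _ (by omega), coeff_seriesAtInfinity_of_lt _ (by omega),
      HahnSeries.coeff_single_of_ne hk.ne]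
    simp
  · subst hk
    have h0 := coeff_seriesAtInfinity_succ (fun m => a ^ m) 0
    rw [coeff_seriesAtInfinity_of_lt _ (show (0 : ℤ) < 1 by omega), HahnSeries.coeff_single_same]
    simpa using h0
  · obtain ⟨m, rfl⟩ : ∃ m : ℕ, k = m + 1 := ⟨(k - 1).toNat, by omega⟩
    have h1 := coeff_seriesAtInfinity_succ (fun m => a ^ m) (m + 1)
    push_cast at h1
    rw [h1, coeff_seriesAtInfinity_succ, HahnSeries.coeff_single_of_ne hk.ne']
    ring

/-- The power sums `m ↦ ∑ a^m` of a multiset. -/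
def powerSum (s : Multiset ℂ) (m : ℕ) : ℂ := (s.map (fun a => a ^ m)).sum

/-- The logarithmic derivative turns the product into a sum, and each factor contributes the
geometric series of `1/(z - a)`. -/
theorem logDeriv_aeval_zInf_prod (s : Multiset ℂ) :
    aeval zInf (derivative (s.map (fun a => X - C a)).prod) /
      aeval zInf (s.map (fun a => X - C a)).prod = seriesAtInfinity (powerSum s) := by
  induction s using Multiset.induction_on with
  | empty =>
    have h : powerSum 0 = 0 := by funext m; simp [powerSum]
    simp [h, seriesAtInfinity_zero]
  | cons a s ih =>
    have h : powerSum (a ::ₘ s) = (fun m => a ^ m) + powerSum s := by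
      funext m; simp [powerSum]
    rw [h, seriesAtInfinity_add, ← ih, Multiset.map_cons, Multiset.prod_cons]
    have hP : aeval zInf (s.map (fun a => X - C a)).prod ≠ 0 :=
      aeval_zInf_ne_zero (monic_multiset_prod_of_monic _ _ fun a _ => monic_X_sub_C a).ne_zero
    have ha := sub_mul_seriesAtInfinity_pow a
    have hne : zInf - algebraMap ℂ (LaurentSeries ℂ) a ≠ 0 := left_ne_zero_of_mul_eq_one ha
    rw [eq_one_div_of_mul_eq_one_right ha]
    rw [derivative_mul, derivative_X_sub_C, one_mul]
    simp only [map_add, map_mul, map_sub, aeval_X, aeval_C]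
    field_simp

theorem expandAtInfinity_polyLogDeriv {Q : ℂ[X]} (hQ : Q.Monic) :
    expandAtInfinity (polyLogDeriv Q) = seriesAtInfinity (powerSum Q.roots) := by
  have h := (IsAlgClosed.splits Q).eq_prod_roots_of_monic hQ
  rw [polyLogDeriv, expandAtInfinity_div, ← logDeriv_aeval_zInf_prod, ← h]

theorem isExpansionAtInfinity_of_isRationalSolution {N : ℕ} {α : ℂ} {P Q : ℂ[X]} (hP : P.Monic)
    (hQ : Q.Monic) (h : IsRationalSolution N α (polyLogDeriv P - polyLogDeriv Q)) :
    IsExpansionAtInfinity N α (powerSum P.roots - powerSum Q.roots) := by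
  have := map_P2 expandAtInfinity expandAtInfinity_ratDeriv RatFunc.X N
    (polyLogDeriv P - polyLogDeriv Q) α
  rw [show P2 ratDeriv RatFunc.X N (polyLogDeriv P - polyLogDeriv Q) α = 0 from h, map_zero,
    expandAtInfinity_X, map_sub, expandAtInfinity_polyLogDeriv hP, expandAtInfinity_polyLogDeriv hQ,
    ← seriesAtInfinity_sub] at this
  exact this.symm

/-! ### Power sums and degree of the Yablonskii–Vorobev polynomials -/

theorem IsYablonskiiVorobev.monic {N n : ℕ} {Q : ℂ[X]} (h : IsYablonskiiVorobev N n Q) :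
    Q.Monic := by
  cases h with
  | zero => exact monic_one
  | succ _ hQ _ => exact hQ

/-- The power sums of the roots of `Q_n^{(N)}` in terms of the expansions at infinity. -/
theorem IsYablonskiiVorobev.powerSum_roots {N n : ℕ} {Q : ℂ[X]} (h : IsYablonskiiVorobev N n Q)
    {c : ℕ → ℕ → ℂ} (hc : ∀ i : ℕ, IsExpansionAtInfinity N (i : ℂ) (c i)) (m : ℕ) :
    powerSum Q.roots m = -∑ i ∈ Finset.Icc 1 n, c i m := by
  induction h with
  | zero => simp [powerSum]
  | @succ n P Q hP hQ hsol ih =>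
    -- Uniqueness of the formal solution identifies `c (n + 1)` with the difference of consecutive
    -- power sums.
    have h1 := congrFun ((hc (n + 1)).unique
      (isExpansionAtInfinity_of_isRationalSolution hP.monic hQ hsol)) m
    rw [Pi.sub_apply, ih] at h1
    rw [Finset.sum_Icc_succ_top (by omega), h1]
    ring

/-- The zeroth power sum counts the roots, and `c i 0 = -i`, so the degree is `1 + ⋯ + n`. -/
theorem IsYablonskiiVorobev.natDegree_eq {N n : ℕ} {Q : ℂ[X]} (h : IsYablonskiiVorobev N n Q) :
    Q.natDegree = n * (n + 1) / 2 := by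
  choose c hc _ using fun i : ℕ => existsUnique_isExpansionAtInfinity N (i : ℂ)
  have h0 := h.powerSum_roots hc 0
  simp only [fun i => (hc i).coeff_zero, powerSum, pow_zero, Multiset.map_const',
    Multiset.sum_replicate, nsmul_eq_mul, mul_one, Finset.sum_neg_distrib, neg_neg,
    IsAlgClosed.card_roots_eq_natDegree] at h0
  have h1 : ∀ n : ℕ, (∑ i ∈ Finset.Icc 1 n, (i : ℂ)) * 2 = n * (n + 1) := by
    intro n
    induction n with
    | zero => simp
    | succ n ih =>
      rw [Finset.sum_Icc_succ_top (by omega), add_mul, ih]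
      push_cast
      ring
  have h2 : Q.natDegree * 2 = n * (n + 1) := by
    have := h1 n
    rw [← h0] at this
    exact_mod_cast this
  omega

/-! ### Newton's identities -/

/-- Newton's identities for the coefficients of a monic polynomial. -/
theorem newton_identity {Q : ℂ[X]} (hQ : Q.Monic) {m : ℕ} (hm : m ≤ Q.natDegree) :
    (m : ℂ) * Q.coeff (Q.natDegree - m) +
      ∑ j ∈ Finset.Icc 1 m, powerSum Q.roots j * Q.coeff (Q.natDegree - (m - j)) = 0 := by
  -- Indexing the roots by `Fin d` allows Newton's identity for symmetric polynomials to be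
  -- evaluated at them.
  obtain ⟨d, f, hf⟩ : ∃ (d : ℕ) (f : Fin d → ℂ), Finset.univ.val.map f = Q.roots := by
    refine ⟨_, Q.roots.toList.get, ?_⟩
    rw [Fin.univ_val_map, List.ofFn_get, Multiset.coe_toList]
  have hcoeff : ∀ k ≤ Q.natDegree, Q.coeff (Q.natDegree - k) = (-1) ^ k * Q.roots.esymm k := by
    intro k hk
    rw [coeff_eq_esymm_roots_of_splits (IsAlgClosed.splits Q) (Nat.sub_le _ _), hQ.leadingCoeff,
      one_mul, Nat.sub_sub_self hk]
  have hpsum : ∀ k, MvPolynomial.aeval f (MvPolynomial.psum _ ℂ k) = powerSum Q.roots k := by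
    intro k
    rw [powerSum, ← hf, Multiset.map_map, MvPolynomial.psum, map_sum]
    simp only [map_pow, MvPolynomial.aeval_X]
    rfl
  have h := congrArg (MvPolynomial.aeval f)
    (MvPolynomial.mul_esymm_eq_sum (Fin d) ℂ m)
  simp only [map_mul, map_sum, map_pow, map_neg, map_one, map_natCast,
    MvPolynomial.aeval_esymm_eq_multiset_esymm, hpsum, hf] at h
  -- Here `a = (m - j, j)`, and `a.1 < m` corresponds to `j ≥ 1`.
  have hsum : ∑ j ∈ Finset.Icc 1 m, powerSum Q.roots j * Q.coeff (Q.natDegree - (m - j)) =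
      ∑ a ∈ Finset.HasAntidiagonal.antidiagonal m with a.1 < m,
        (-1) ^ a.1 * Q.roots.esymm a.1 * powerSum Q.roots a.2 := by
    symm
    refine Finset.sum_bij' (fun a _ => a.2) (fun j _ => (m - j, j)) ?_ ?_ ?_ ?_ ?_
    · intro a ha
      simp only [Finset.mem_filter, Finset.HasAntidiagonal.mem_antidiagonal, Finset.mem_Icc] at ha ⊢
      omega
    · intro j hj
      simp only [Finset.mem_filter, Finset.HasAntidiagonal.mem_antidiagonal, Finset.mem_Icc] at hj ⊢
      omega
    · intro a ha
      simp only [Finset.mem_filter, Finset.HasAntidiagonal.mem_antidiagonal] at ha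
      ext
      · simp only; omega
      · rfl
    · intro j _; rfl
    · intro a ha
      simp only [Finset.mem_filter, Finset.HasAntidiagonal.mem_antidiagonal] at ha
      rw [show m - a.2 = a.1 by omega, hcoeff a.1 (by omega)]
      ring
  have hsq : ((-1 : ℂ) ^ m) * (-1) ^ m = 1 := by rw [← mul_pow]; simp
  rw [hsum, hcoeff m hm]
  linear_combination (-1) ^ m * h -
    (∑ a ∈ Finset.HasAntidiagonal.antidiagonal m with a.1 < m,
        (-1) ^ a.1 * Q.roots.esymm a.1 * powerSum Q.roots a.2) * hsq

/-- Newton's identities characterize the coefficients of a monic polynomial. -/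
theorem newton_iff {Q : ℂ[X]} (hQ : Q.Monic) (A : ℕ → ℂ) :
    (A 0 = 1 ∧ ∀ m ∈ Finset.Icc 1 Q.natDegree,
      (m : ℂ) * A m + ∑ j ∈ Finset.Icc 1 m, powerSum Q.roots j * A (m - j) = 0) ↔
    ∀ m ≤ Q.natDegree, A m = Q.coeff (Q.natDegree - m) := by
  constructor
  · rintro ⟨h0, h⟩ m
    induction m using Nat.strong_induction_on with
    | _ m ih =>
      intro hm
      rcases Nat.eq_zero_or_pos m with rfl | hpos
      · rw [h0, Nat.sub_zero, hQ.coeff_natDegree]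
      · have h1 := h m (Finset.mem_Icc.mpr ⟨hpos, hm⟩)
        have h2 := newton_identity hQ hm
        have h3 : ∑ j ∈ Finset.Icc 1 m, powerSum Q.roots j * A (m - j) =
            ∑ j ∈ Finset.Icc 1 m, powerSum Q.roots j * Q.coeff (Q.natDegree - (m - j)) := by
          refine Finset.sum_congr rfl fun j hj => ?_
          rw [Finset.mem_Icc] at hj
          rw [ih (m - j) (by omega) (by omega)]
        have hm0 : (m : ℂ) ≠ 0 := Nat.cast_ne_zero.mpr hpos.ne'
        apply mul_left_cancel₀ hm0
        linear_combination h1 - h2 - h3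
  · intro h
    refine ⟨by rw [h 0 (Nat.zero_le _), Nat.sub_zero, hQ.coeff_natDegree], fun m hm => ?_⟩
    rw [Finset.mem_Icc] at hm
    rw [← newton_identity hQ hm.2, h m hm.2]
    congr 1
    refine Finset.sum_congr rfl fun j hj => ?_
    rw [h (m - j) (by omega)]

/-- A monic polynomial is determined by its degree and the power sums of its roots. -/
theorem eq_of_powerSum_roots_eq {P Q : ℂ[X]} (hP : P.Monic) (hQ : Q.Monic)
    (h : powerSum P.roots = powerSum Q.roots) : P = Q := by
  have hd : P.natDegree = Q.natDegree := by
    have h0 := congrFun h 0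
    simpa [powerSum, IsAlgClosed.card_roots_eq_natDegree] using h0
  -- The coefficients of `P` solve Newton's identities of `P`, which are also those of `Q`.
  have hA := (newton_iff hP fun m => P.coeff (P.natDegree - m)).mpr fun _ _ => rfl
  rw [h, hd] at hA
  have hB := (newton_iff hQ fun m => P.coeff (Q.natDegree - m)).mp hA
  ext k
  by_cases hk : k ≤ Q.natDegree
  · have := hB (Q.natDegree - k) (Nat.sub_le _ _)
    simpa [Nat.sub_sub_self hk] using this
  · rw [coeff_eq_zero_of_natDegree_lt (by omega), coeff_eq_zero_of_natDegree_lt (by omega)]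

/-- If the power sums of the roots vanish off the multiples of `M`, so do the coefficients. -/
theorem coeff_eq_zero_of_powerSum_eq_zero {Q : ℂ[X]} (hQ : Q.Monic) {M : ℕ}
    (h : ∀ j, ¬ M ∣ j → powerSum Q.roots j = 0) {m : ℕ} (hm : m ≤ Q.natDegree) (hM : ¬ M ∣ m) :
    Q.coeff (Q.natDegree - m) = 0 := by
  induction m using Nat.strong_induction_on with
  | _ m ih =>
    have h1 := newton_identity hQ hm
    rw [Finset.sum_eq_zero, add_zero] at h1
    · have hm0 : (m : ℂ) ≠ 0 := Nat.cast_ne_zero.mpr (by rintro rfl; exact hM (dvd_zero _))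
      exact (mul_eq_zero.mp h1).resolve_left hm0
    -- If `M ∣ j`, then `M ∤ m - j` and induction kills the coefficient; otherwise the power sum
    -- vanishes.
    · intro j hj
      rw [Finset.mem_Icc] at hj
      by_cases hMj : M ∣ j
      · rw [ih (m - j) (by omega) (by omega), mul_zero]
        intro hd
        apply hM
        have := dvd_add hd hMj
        rwa [Nat.sub_add_cancel hj.2] at this
      · rw [h j hMj, zero_mul]

/-- A polynomial whose exponents are all congruent to its degree modulo `M` is `X^r q(X^M)`. -/
theorem exists_eq_X_pow_mul_comp {Q : ℂ[X]} (hQ : Q.Monic) {M : ℕ} (hM : 0 < M)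
    (h : ∀ m ≤ Q.natDegree, ¬ M ∣ m → Q.coeff (Q.natDegree - m) = 0) :
    ∃ q : ℂ[X], Q = X ^ (Q.natDegree % M) * q.comp (X ^ M) ∧ q.natDegree = Q.natDegree / M := by
  set d := Q.natDegree with hd
  -- Dropping the exponents below `d % M` and keeping every `M`-th one after that gives `q_l = Q_{lM
  -- + d % M}`.
  set q : ℂ[X] := contract M (divX^[d % M] Q) with hq
  have hdiv : ∀ r k, (divX^[r] Q).coeff k = Q.coeff (k + r) := by
    intro r
    induction r with
    | zero => intro k; rfl
    | succ r ih => intro k; rw [Function.iterate_succ_apply', coeff_divX, ih]; congr 1; ring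
  have hqc : ∀ l, q.coeff l = Q.coeff (l * M + d % M) := by
    intro l
    rw [hq, coeff_contract hM.ne', hdiv]
  have hQq : Q = X ^ (d % M) * q.comp (X ^ M) := by
    ext k
    rw [← expand_eq_comp_X_pow, coeff_X_pow_mul']
    split_ifs with hk
    · rw [coeff_expand hM]
      split_ifs with hdvd
      · rw [hqc, Nat.div_mul_cancel hdvd, Nat.sub_add_cancel hk]
      · by_cases hkd : k ≤ d
        · have h1 := h (d - k) (Nat.sub_le _ _)
          rw [Nat.sub_sub_self hkd] at h1
          apply h1
          intro h2
          apply hdvd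
          rw [← Nat.modEq_iff_dvd' hk]
          exact (Nat.mod_modEq d M).trans ((Nat.modEq_iff_dvd' hkd).mpr h2).symm
        · exact coeff_eq_zero_of_natDegree_lt (by omega)
    -- An exponent `k < d % M` has residue at most `k`, hence not that of `d`.
    · have hkd : k ≤ d := by have := Nat.mod_le d M; omega
      have h1 := h (d - k) (Nat.sub_le _ _)
      rw [Nat.sub_sub_self hkd] at h1
      apply h1
      intro h2
      have h3 : k % M = d % M := (Nat.modEq_iff_dvd' hkd).mpr h2
      have := Nat.mod_le k M
      omega
  refine ⟨q, hQq, ?_⟩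
  have hdm : d / M * M + d % M = d := Nat.div_add_mod' d M
  refine natDegree_eq_of_le_of_coeff_ne_zero ?_ ?_
  · rw [natDegree_le_iff_coeff_eq_zero]
    intro l hl
    rw [hqc]
    refine coeff_eq_zero_of_natDegree_lt ?_
    have : (d / M) * M < l * M := Nat.mul_lt_mul_of_pos_right hl hM
    omega
  · rw [hqc, hdm, hd, hQ.coeff_natDegree]
    exact one_ne_zero

end PainleveTwo

/-! ### The main theorem -/

open PainleveTwo in
theorem theorem3 (N : ℕ) (hN : 1 ≤ N) :
    (∀ α : ℂ, ∃ c : ℕ → ℂ, PainleveTwo.IsExpansionAtInfinity N α c ∧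
      (∀ c' : ℕ → ℂ, PainleveTwo.IsExpansionAtInfinity N α c' → c' = c) ∧
      c 0 = -α ∧ ∀ m : ℕ, ¬ (2 * N + 1) ∣ m → c m = 0) ∧
    ∀ c : ℕ → ℕ → ℂ, (∀ i : ℕ, PainleveTwo.IsExpansionAtInfinity N (i : ℂ) (c i)) →
    ∀ (n : ℕ) (Q : Polynomial ℂ), PainleveTwo.IsYablonskiiVorobev N n Q →
      (∀ Q' : Polynomial ℂ, PainleveTwo.IsYablonskiiVorobev N n Q' → Q' = Q) ∧
      Q.Monic ∧
      Q.natDegree = n * (n + 1) / 2 ∧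
      (Q.natDegree : ℂ) = -∑ i ∈ Finset.Icc 1 n, c i 0 ∧
      (∀ m : ℕ, 1 ≤ m → (Q.roots.map (fun a => a ^ m)).sum = -∑ i ∈ Finset.Icc 2 n, c i m) ∧
      (∀ A : ℕ → ℂ,
        (A 0 = 1 ∧ ∀ m ∈ Finset.Icc 1 (n * (n + 1) / 2),
          (m : ℂ) * A m +
            ∑ j ∈ Finset.Icc 1 m, (-∑ i ∈ Finset.Icc 2 n, c i j) * A (m - j) = 0) ↔
        ∀ m ≤ n * (n + 1) / 2, A m = Q.coeff (n * (n + 1) / 2 - m)) ∧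
      (∀ m ≤ n * (n + 1) / 2, ¬ (2 * N + 1) ∣ m → Q.coeff (n * (n + 1) / 2 - m) = 0) ∧
      (∃ q : Polynomial ℂ,
        Q = Polynomial.X ^ (n * (n + 1) / 2 % (2 * N + 1)) * q.comp (Polynomial.X ^ (2 * N + 1)) ∧
        q.natDegree = n * (n + 1) / (4 * N + 2)) ∧
      (n % (2 * N + 1) = 0 ∨ n % (2 * N + 1) = 2 * N → (2 * N + 1) ∣ n * (n + 1) / 2) := by
  refine ⟨existsUnique_isExpansionAtInfinity N, fun c hc n Q hQ => ?_⟩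
  have hmonic := hQ.monic
  have hdeg := hQ.natDegree_eq
  have hpow : ∀ m : ℕ, 1 ≤ m → powerSum Q.roots m = -∑ i ∈ Finset.Icc 2 n, c i m := by
    intro m hm
    rw [hQ.powerSum_roots hc m]
    rcases Nat.eq_zero_or_pos n with rfl | hn
    · simp
    -- The solution for `α = 1` is exactly `-1/z`, so the sum may start at `i = 2`.
    · have h1 : c 1 m = 0 := by
        have h1 := (hc 1).unique (by simpa using isExpansionAtInfinity_one hN)
        rw [h1]
        exact if_neg (Nat.one_le_iff_ne_zero.mp hm)
      rw [← Finset.insert_Icc_succ_left_eq_Icc hn, Finset.sum_insert (by simp), h1, zero_add]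
      rfl
  have hzero : ∀ j, ¬ (2 * N + 1) ∣ j → powerSum Q.roots j = 0 := by
    intro j hj
    rw [hQ.powerSum_roots hc j, Finset.sum_eq_zero fun i _ => (hc i).eq_zero_of_not_dvd hj, neg_zero]
  have hsparse : ∀ m ≤ Q.natDegree, ¬ (2 * N + 1) ∣ m → Q.coeff (Q.natDegree - m) = 0 :=
    fun m hm hM => coeff_eq_zero_of_powerSum_eq_zero hmonic hzero hm hM
  refine ⟨fun Q' hQ' => ?_, hmonic, hdeg, ?_, hpow, fun A => ?_, ?_, ?_, fun hn => ?_⟩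
  · refine eq_of_powerSum_roots_eq hQ'.monic hmonic (funext fun m => ?_)
    rw [hQ'.powerSum_roots hc, hQ.powerSum_roots hc]
  · rw [← hQ.powerSum_roots hc 0]
    simp [powerSum, IsAlgClosed.card_roots_eq_natDegree]
  · rw [← hdeg, ← newton_iff hmonic A]
    refine and_congr_right fun _ => forall₂_congr fun m _ => ?_
    rw [Finset.sum_congr rfl fun j hj => by rw [← hpow j (Finset.mem_Icc.mp hj).1]]
  · rwa [hdeg] at hsparse
  · obtain ⟨q, h1, h2⟩ := exists_eq_X_pow_mul_comp hmonic (M := 2 * N + 1) (by omega) hsparse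
    rw [hdeg] at h1 h2
    refine ⟨q, h1, ?_⟩
    rw [h2, Nat.div_div_eq_div_mul]
    congr 1
    ring
  · have h2 : n * (n + 1) / 2 * 2 = n * (n + 1) :=
      Nat.div_mul_cancel (Nat.even_mul_succ_self n).two_dvd
    -- As `2N + 1` is odd, it is enough that it divides `2 p_n = n(n + 1)`; it divides `n` in the
    -- first case and `n + 1` in the second.
    have hcop : Nat.Coprime (2 * N + 1) 2 := by simp
    refine hcop.dvd_of_dvd_mul_right ?_
    rw [h2]
    rcases hn with hn | hn
    · exact (Nat.dvd_of_mod_eq_zero hn).mul_right _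
    · refine Dvd.dvd.mul_left (Nat.dvd_of_mod_eq_zero ?_) _
      rw [Nat.add_mod, hn]
      rw [Nat.mod_eq_of_lt (show 1 < 2 * N + 1 by omega), Nat.mod_self]

end
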